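/- Let $S$ be the substitution $R\mapsto RLR^2$, $L\mapsto LR^2$ acting letterwise on words in $R,L$, let $\bar C_1=R$ and $\bar C_{n+1}=S(\bar C_n)$ for $n\ge 1$ (so $\bar C_2=RLR^2$), and let $C_n=|\bar C_n|$ be the length of $\bar C_n$. For a nonempty word $\bar W$ let $K_1K_2\ldots$ be the periodic sequence $(\bar W|_C)^\infty$, where $\bar W|_C$ is $\bar W$ with its last letter replaced by $C$. Put $\Theta^0=1$ and $\Theta^k=\prod_{i=1}^k\epsilon_i$, where $\epsilon_i=1$ if $K_i=L$, $\epsilon_i=-1$ if $K_i=R$, and $\epsilon_{k+1}=\prod_{i=1}^{k}\epsilon_i$ if $K_{k+1}=C$. Let $D_{\bar W}(x)=\sum_{k=0}^{|\bar W|-1}\Theta^kx^k$ be the finite degree kneading determinant and write $D_n=D_{\bar C_n}$. Let $\tau_n$ be the smallest positive zero of $D_n$ (for $n\ge2$; $D_1=1$ has no zero), and let $h_n=-\ln\tau_n$ be the topological entropy of the superstable word $\bar C_n$, given by the Milnor–Thurston formula. (1) For $n\ge2$, $\bar C_{n-1}$ is a prefix of $\bar C_n$, and $\bar C_{n+1}=\bar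 C_n\,\bar C_{n-1}^{-1}\,\bar C_n^{3}$, where $A^{-1}(AB)=B$. The lengths satisfy $C_1=1$, $C_2=4$, $C_{n-1}<C_n$ and $C_{n+1}=4C_n-C_{n-1}$ for $n\ge2$, and every $\bar C_n$ ($n\ge1$) contains an odd number of letters $R$. (2) For $n\ge1$ and $|x|<1$, the full kneading determinant of $(\bar C_n|_C)^\infty$ is $\sum_{k\ge0}\Theta^kx^k=D_n(x)/(1-x^{C_n})$. (3) For $n\ge2$, $D_n-D_{n-1}=-x^{C_{n-1}}D_{\bar C_{n-1}^{-1}\bar C_n}$ and $D_{n+1}=a_{n+1}D_n+b_{n+1}D_{n-1}$, where $$a_{n+1}=1+x^{C_n-C_{n-1}}-x^{2C_n-C_{n-1}}+x^{3C_n-C_{n-1}},\qquad b_{n+1}=-x^{C_n-C_{n-1}};$$ the only real zero of $b_{n+1}$ is $x=0$. (4) For $n\ge2$, $\tau_n$ exists, $\tfrac12\le\tau_n\le1$, $b_{n+1}(\tau_n)\ne0$, and $\tau_{n+1}<\tau_n$. (5) The sequence $h_n$ converges to a limit $h_\infty$ with $0.4484\le h_\infty<0.4485$, and, as $n\to\infty$,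 $$\frac{h_n-h_{n-1}}{h_{n+1}-h_n}\sim\exp\Big\{\exp\Big[n\ln(2+\sqrt3)+\ln\Big(\tfrac{1+\sqrt3}{6+4\sqrt3}\,h_\infty\Big)\Big]\Big\}$$ in the sense that the quotient of the two sides tends to $1$; moreover $$\ln\ln\frac{h_n-h_{n-1}}{h_{n+1}-h_n}-\Big[n\ln(2+\sqrt3)+\ln\Big(\tfrac{1+\sqrt3}{6+4\sqrt3}\,h_\infty\Big)\Big]\longrightarrow0 .$$ -/

import Mathlib

open Filter Topology Asymptotics

/-- The alphabet `{L, R, C}` of symbolic dynamics of unimodal maps. -/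
inductive Letter
  | L
  | R
  | C
  deriving DecidableEq

/-- Finite words; concatenation is `++`, and the number of letters is `List.length`. -/
abbrev Word := List Letter

namespace Word

/-- The number of letters `R` in a word; the word is odd if this number is odd. -/
def numR (W : Word) : ℕ := W.count Letter.R

/-- `A⁻¹ B`, meaningful when `A` is a prefix of `B`: the word `V` with `B = A V`. -/
def invMul (A B : Word) : Word := B.drop A.length

/-- The defining law `A⁻¹ (A B) = B` of inverse words. -/
theorem invMul_append (A B : Word) : invMul A (A ++ B) = B := by
  simp [invMul]

/-- `W|_C`: the final letter of `W` is replaced by `C`. -/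
def atC (W : Word) : Word := W.dropLast ++ [Letter.C]

/-- The superstable kneading sequence `(W|_C)^∞` (for nonempty `W`); the entry with index `i`
is the letter `K_{i+1}`. -/
def kneadingSeq (W : Word) : ℕ → Letter := fun i => (atC W).getD (i % W.length) Letter.C

/-- The invariant coordinate `Θ^n = ε_1 ⋯ ε_n` of the sequence `K_1 K_2 …` (where `K i` is
`K_{i+1}`), with `ε_i = 1` if `K_i = L`, `ε_i = -1` if `K_i = R`, and
`ε_{k+1} = ε_1 ⋯ ε_k = Θ^k` if `K_{k+1} = C`. -/
def invCoord (K : ℕ → Letter) : ℕ → ℤ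
  | 0 => 1
  | n + 1 => invCoord K n *
      (match K n with
        | Letter.L => 1
        | Letter.R => -1
        | Letter.C => invCoord K n)

/-- The finite degree kneading determinant `D_W(x) = ∑_{n < |W|} Θ^n x^n`. -/
noncomputable def kneadingDet (W : Word) : Polynomial ℝ :=
  ∑ n ∈ Finset.range W.length,
    Polynomial.C ((invCoord (kneadingSeq W) n : ℤ) : ℝ) * Polynomial.X ^ n

/-- The set of positive zeros of `D_W`. -/
def posZeros (W : Word) : Set ℝ := {x : ℝ | 0 < x ∧ (kneadingDet W).eval x = 0}

/-- The smallest positive zero of `D_W` (when `D_W` has a positive zero). -/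
noncomputable def smallestZero (W : Word) : ℝ := sInf (posZeros W)

/-- The topological entropy `h(W^∞) = -ln τ` of the superstable word `W`, where `τ` is the
smallest positive zero of the kneading determinant (when there is one). -/
noncomputable def entropy (W : Word) : ℝ := -Real.log (smallestZero W)

end Word

namespace Clapeyron

/-- The substitution rules `R → RLR²`, `L → LR²` (the letter `C` does not occur in the words to
which they are applied). -/
def rule : Letter → Word
  | Letter.R => [Letter.R, Letter.L, Letter.R, Letter.R]
  | Letter.L => [Letter.L, Letter.R, Letter.R]
  | Letter.C => [Letter.C]

/-- The rules applied to each letter of a word. -/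
def subst (W : Word) : Word := W.flatMap rule

/-- The Clapeyron words, numbered from `n = 1`: the `n`-th one is obtained from the word `R` by
`n - 1` substitutions. -/
def word (n : ℕ) : Word := subst^[n - 1] [Letter.R]

/-- `C_n`, the length of the `n`-th Clapeyron word. -/
def len (n : ℕ) : ℕ := (word n).length

/-- `D_n`, the finite degree kneading determinant of the `n`-th Clapeyron word. -/
noncomputable def D (n : ℕ) : Polynomial ℝ := (word n).kneadingDet

/-- `τ_n`, the smallest positive zero of `D_n`. -/
noncomputable def τ (n : ℕ) : ℝ := (word n).smallestZero

/-- `h_n = -ln τ_n`, the topological entropy of the `n`-th Clapeyron word. -/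
noncomputable def h (n : ℕ) : ℝ := (word n).entropy

/-- `a_{n+1} = 1 + x^(C_n - C_{n-1}) - x^(2 C_n - C_{n-1}) + x^(3 C_n - C_{n-1})`
as a function of `n`. -/
noncomputable def aSucc (n : ℕ) : Polynomial ℝ :=
  1 + Polynomial.X ^ (len n - len (n - 1)) - Polynomial.X ^ (2 * len n - len (n - 1))
    + Polynomial.X ^ (3 * len n - len (n - 1))

/-- `b_{n+1} = -x^(C_n - C_{n-1})` as a function of `n`. -/
noncomputable def bSucc (n : ℕ) : Polynomial ℝ :=
  -Polynomial.X ^ (len n - len (n - 1))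

end Clapeyron

/-! Replacing the last letter by `C` does not affect the finite determinant, so each `D n` is the
polynomial of prefix signs of its word, and concatenation of words becomes an affine identity
between these polynomials. The substitution is a morphism, so one identity between short words
propagates to all levels. Since every Clapeyron word has sign -1 and every `suffix n` has sign 1,
this gives `D_recursion`.

At a zero of D_n the recursion reduces to D_{n+1}(τ_n) = -τ_n^(C_n - C_{n-1}) D_{n-1}(τ_n). By
induction the right side is negative, and D_{n+1}(0) = 1, so D_{n+1} vanishes before τ_n (`τ_spec`).

For the asymptotics, apply the mean value theorem to both sides of this identity. The quotient of
successive gaps between zeros is τ_n^(-(C_n - C_{n-1})) = exp(h_n (C_n - C_{n-1})) times a quotient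
of derivatives (`exists_ratio_eq`). That quotient tends to 1, because the determinants share ever
longer initial segments and their slopes near the limit stay below -1/2 (`eval_derivative_D_le`).
Replacing h_n by its limit costs nothing: h_n converges doubly exponentially, while the lengths grow
only like (2 + √3)^n. The logarithm of the ratio is thus known up to o(1), which yields both
asymptotic claims. -/

namespace Word

/-! ### Kneading determinants as polynomials of prefix signs -/

/-- The sign contributed by a letter to the invariant coordinate. -/
def letterSign : Letter → ℝ
  | Letter.R => -1
  | _ => 1

/-- The product of the signs of the letters of a word. -/
def wordSign (W : Word) : ℝ := (W.map letterSign).prod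

/-- The polynomial `∑_{k < |W|} (sign of the first k letters) x^k`. -/
noncomputable def detPoly : Word → Polynomial ℝ
  | [] => 0
  | l :: W => 1 + Polynomial.C (letterSign l) * Polynomial.X * detPoly W

@[simp] theorem wordSign_nil : wordSign [] = 1 := rfl

@[simp] theorem wordSign_cons (l : Letter) (W : Word) :
    wordSign (l :: W) = letterSign l * wordSign W := by
  simp [wordSign]

@[simp] theorem wordSign_append (A B : Word) :
    wordSign (A ++ B) = wordSign A * wordSign B := by
  simp [wordSign]

theorem wordSign_eq_neg_one_pow (W : Word) : wordSign W = (-1) ^ W.numR := by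
  induction W with
  | nil => simp [numR]
  | cons l W ih => cases l <;> simp_all [numR, letterSign, pow_succ]

theorem abs_letterSign (l : Letter) : |letterSign l| = 1 := by
  cases l <;> simp [letterSign]

/-- Every prefix reaching beyond `A` carries the sign and the length of `A` as common factors. -/
theorem detPoly_append (A B : Word) :
    detPoly (A ++ B) =
      detPoly A + Polynomial.C (wordSign A) * Polynomial.X ^ A.length * detPoly B := by
  induction A with
  | nil => simp [detPoly]
  | cons l A ih =>
    simp only [List.cons_append, detPoly, ih, wordSign_cons, List.length_cons, Polynomial.C_mul]
    ring

theorem detPoly_eq_sum (W : Word) :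
    detPoly W = ∑ k ∈ Finset.range W.length,
      Polynomial.C (wordSign (W.take k)) * Polynomial.X ^ k := by
  induction W with
  | nil => simp [detPoly]
  | cons l W ih =>
    rw [List.length_cons, Finset.sum_range_succ', detPoly, ih, Finset.mul_sum, add_comm]
    congr 1
    · refine Finset.sum_congr rfl fun k _ => ?_
      simp only [List.take_succ_cons, wordSign_cons, Polynomial.C_mul]
      ring
    · simp

theorem kneadingSeq_of_lt (W : Word) {k : ℕ} (hk : k + 1 < W.length) :
    kneadingSeq W k = W[k] := by
  have h1 : k % W.length = k := Nat.mod_eq_of_lt (by omega)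
  have h2 : k < W.dropLast.length := by simp; omega
  simp [kneadingSeq, atC, h1, List.getD_eq_getElem?_getD, List.getElem?_append_left h2,
    List.getElem?_eq_getElem h2]

theorem kneadingSeq_last (W : Word) (hW : W ≠ []) :
    kneadingSeq W (W.length - 1) = Letter.C := by
  have h0 : 0 < W.length := List.length_pos_iff.2 hW
  have h1 : (W.length - 1) % W.length = W.length - 1 := Nat.mod_eq_of_lt (by omega)
  have h2 : W.length - 1 = W.dropLast.length := by simp
  simp [kneadingSeq, atC, h1, List.getD_eq_getElem?_getD]

theorem kneadingSeq_add_length (W : Word) (k : ℕ) :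
    kneadingSeq W (k + W.length) = kneadingSeq W k := by
  simp [kneadingSeq]

/-- Only the first `k` letters enter, so for `k < W.length` the final `C` is never read. -/
theorem invCoord_eq_wordSign (W : Word) (hW : Letter.C ∉ W) {k : ℕ} (hk : k < W.length) :
    ((invCoord (kneadingSeq W) k : ℤ) : ℝ) = wordSign (W.take k) := by
  induction k with
  | zero => simp [invCoord]
  | succ k ih =>
    have hl : W[k] ∈ W := List.getElem_mem _
    rw [invCoord, kneadingSeq_of_lt W hk, List.take_succ_eq_append_getElem (by omega),
      wordSign_append, ← ih (by omega)]
    cases hc : W[k] <;> simp_all [letterSign]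

theorem kneadingDet_eq_detPoly (W : Word) (hW : Letter.C ∉ W) : kneadingDet W = detPoly W := by
  rw [detPoly_eq_sum, kneadingDet]
  refine Finset.sum_congr rfl fun k hk => ?_
  rw [invCoord_eq_wordSign W hW (Finset.mem_range.1 hk)]

theorem abs_invCoord (K : ℕ → Letter) (k : ℕ) : |invCoord K k| = 1 := by
  induction k with
  | zero => simp [invCoord]
  | succ k ih => rw [invCoord, abs_mul, ih]; cases K k <;> simp [ih]

/-- The sign at `C` repeats the coordinate reached so far, so the product is the square of ±1. This
is what makes the coordinates periodic. -/
theorem invCoord_length (W : Word) (hW : W ≠ []) :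
    invCoord (kneadingSeq W) W.length = 1 := by
  have h0 : 0 < W.length := List.length_pos_iff.2 hW
  obtain ⟨m, hm⟩ : ∃ m, W.length = m + 1 := ⟨W.length - 1, by omega⟩
  have h1 := kneadingSeq_last W hW
  have h2 : W.length - 1 = m := by omega
  rw [h2] at h1
  rw [hm, invCoord, h1]
  have := abs_invCoord (kneadingSeq W) m
  simp only
  rw [← abs_mul_abs_self, this, one_mul]

theorem invCoord_add_length (W : Word) (hW : W ≠ []) (k : ℕ) :
    invCoord (kneadingSeq W) (k + W.length) = invCoord (kneadingSeq W) k := by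
  induction k with
  | zero => simp [invCoord_length W hW, invCoord]
  | succ k ih =>
    rw [Nat.add_right_comm, invCoord, kneadingSeq_add_length, ih, invCoord]

/-- The kneading determinant of a superstable sequence is a geometric multiple of the finite
degree one. -/
theorem hasSum_invCoord (W : Word) (hW : W ≠ []) {x : ℝ} (hx : |x| < 1) :
    HasSum (fun k : ℕ => ((invCoord (kneadingSeq W) k : ℤ) : ℝ) * x ^ k)
      ((kneadingDet W).eval x / (1 - x ^ W.length)) := by
  set f : ℕ → ℝ := fun k => ((invCoord (kneadingSeq W) k : ℤ) : ℝ) * x ^ k with hf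
  have hs : Summable f := by
    refine Summable.of_norm_bounded (g := fun k => |x| ^ k)
      (summable_geometric_of_lt_one (abs_nonneg x) hx) fun k => ?_
    have := abs_invCoord (kneadingSeq W) k
    rw [hf, Real.norm_eq_abs, abs_mul, abs_pow, ← Int.cast_abs, this]
    simp
  have h1 := hs.sum_add_tsum_nat_add W.length
  have h2 : (fun k => f (k + W.length)) = fun k => x ^ W.length * f k := by
    funext k
    simp only [hf, invCoord_add_length W hW, pow_add]
    ring
  have h3 : ∑ k ∈ Finset.range W.length, f k = (kneadingDet W).eval x := by
    simp [kneadingDet, Polynomial.eval_finsetSum, hf]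
  rw [h2, tsum_mul_left, h3] at h1
  have h4 : 1 - x ^ W.length ≠ 0 := by
    have : |x ^ W.length| < 1 := by
      rw [abs_pow]
      exact pow_lt_one₀ (abs_nonneg x) hx (List.length_pos_iff.2 hW).ne'
    have := (abs_lt.1 this).2
    linarith
  have h5 : (kneadingDet W).eval x / (1 - x ^ W.length) = ∑' k, f k := by
    rw [div_eq_iff h4]
    linarith
  rw [h5]
  exact hs.hasSum

/-! ### Bounds uniform in the word, by comparison with the geometric series -/

theorem abs_eval_detPoly_le (W : Word) {x : ℝ} (h0 : 0 ≤ x) (h1 : x < 1) :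
    |(detPoly W).eval x| ≤ 1 / (1 - x) := by
  have hp : 0 < 1 - x := by linarith
  induction W with
  | nil => simp [detPoly]; exact h1.le
  | cons l W ih =>
    calc |(detPoly (l :: W)).eval x| = |1 + letterSign l * x * (detPoly W).eval x| := by
          simp [detPoly]
      _ ≤ |1| + |letterSign l * x * (detPoly W).eval x| := abs_add_le _ _
      _ = 1 + x * |(detPoly W).eval x| := by
          rw [abs_mul, abs_mul, abs_letterSign, abs_of_nonneg h0]; simp
      _ ≤ 1 + x * (1 / (1 - x)) := by gcongr
      _ = 1 / (1 - x) := by field_simp; ring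

theorem abs_eval_derivative_detPoly_le (W : Word) {x : ℝ} (h0 : 0 ≤ x) (h1 : x < 1) :
    |(detPoly W).derivative.eval x| ≤ 1 / (1 - x) ^ 2 := by
  have hp : 0 < 1 - x := by linarith
  induction W with
  | nil => simp [detPoly]; positivity
  | cons l W ih =>
    calc |(detPoly (l :: W)).derivative.eval x|
        = |letterSign l * ((detPoly W).eval x + x * (detPoly W).derivative.eval x)| := by
          congr 1; simp [detPoly]; ring
      _ = |(detPoly W).eval x + x * (detPoly W).derivative.eval x| := by
          rw [abs_mul, abs_letterSign, one_mul]
      _ ≤ |(detPoly W).eval x| + x * |(detPoly W).derivative.eval x| := by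
          refine (abs_add_le _ _).trans_eq ?_
          rw [abs_mul, abs_of_nonneg h0]
      _ ≤ 1 / (1 - x) + x * (1 / (1 - x) ^ 2) := by
          gcongr
          exact abs_eval_detPoly_le W h0 h1
      _ = 1 / (1 - x) ^ 2 := by field_simp; ring

theorem abs_eval_derivative_derivative_detPoly_le (W : Word) {x : ℝ} (h0 : 0 ≤ x) (h1 : x < 1) :
    |(detPoly W).derivative.derivative.eval x| ≤ 2 / (1 - x) ^ 3 := by
  have hp : 0 < 1 - x := by linarith
  induction W with
  | nil => simp [detPoly]; positivity
  | cons l W ih =>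
    calc |(detPoly (l :: W)).derivative.derivative.eval x|
        = |letterSign l * (2 * (detPoly W).derivative.eval x +
            x * (detPoly W).derivative.derivative.eval x)| := by
          congr 1; simp [detPoly]; ring
      _ = |2 * (detPoly W).derivative.eval x +
            x * (detPoly W).derivative.derivative.eval x| := by
          rw [abs_mul, abs_letterSign, one_mul]
      _ ≤ 2 * |(detPoly W).derivative.eval x| +
            x * |(detPoly W).derivative.derivative.eval x| := by
          refine (abs_add_le _ _).trans_eq ?_
          rw [abs_mul, abs_mul, abs_of_nonneg h0, abs_two]
      _ ≤ 2 * (1 / (1 - x) ^ 2) + x * (2 / (1 - x) ^ 3) := by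
          gcongr
          exact abs_eval_derivative_detPoly_le W h0 h1
      _ = 2 / (1 - x) ^ 3 := by field_simp; ring

/-- The constant term 1 dominates the remaining terms, whose sum is at most x/(1 - x) < 1 in
absolute value. -/
theorem eval_detPoly_pos (W : Word) (hW : W ≠ []) {x : ℝ} (h0 : 0 ≤ x) (h1 : x < 1 / 2) :
    0 < (detPoly W).eval x := by
  obtain ⟨l, W, rfl⟩ := List.exists_cons_of_ne_nil hW
  have h2 := abs_eval_detPoly_le W h0 (by linarith)
  have hp : 0 < 1 - x := by linarith
  have h3 : |letterSign l * x * (detPoly W).eval x| < 1 := by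
    rw [abs_mul, abs_mul, abs_letterSign, abs_of_nonneg h0, one_mul]
    calc x * |(detPoly W).eval x| ≤ x * (1 / (1 - x)) := by gcongr
      _ < 1 := by rw [mul_one_div, div_lt_one hp]; linarith
  have h4 := (abs_lt.1 h3).1
  have : (detPoly (l :: W)).eval x = 1 + letterSign l * x * (detPoly W).eval x := by
    simp [detPoly]
  linarith

end Word

/-! ### Combinatorics of the Clapeyron words -/

namespace Clapeyron

open Word

@[simp] theorem subst_append (A B : Word) : subst (A ++ B) = subst A ++ subst B := by
  simp [subst]

/-- The word `V` with `word (n + 2) = word (n + 1) ++ V`. -/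
def suffix (n : ℕ) : Word := subst^[n] [Letter.L, Letter.R, Letter.R]

theorem word_succ_succ (n : ℕ) : word (n + 2) = subst (word (n + 1)) := by
  simp [word, Function.iterate_succ_apply']

theorem suffix_succ (n : ℕ) : suffix (n + 1) = subst (suffix n) := by
  simp [suffix, Function.iterate_succ_apply']

theorem word_eq_append_suffix (n : ℕ) : word (n + 2) = word (n + 1) ++ suffix n := by
  induction n with
  | zero => decide
  | succ n ih =>
    have h := congrArg subst ih
    simpa only [subst_append, ← word_succ_succ, ← suffix_succ] using h

/-- The case n = 0 is a direct computation; applying the morphism `subst` to it gives all others. -/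
theorem word_recursion (n : ℕ) :
    word (n + 3) = word (n + 2) ++ suffix n ++ word (n + 2) ++ word (n + 2) := by
  induction n with
  | zero => decide
  | succ n ih =>
    have h := congrArg subst ih
    simpa only [subst_append, ← word_succ_succ, ← suffix_succ] using h

theorem numR_subst (W : Word) (hW : Letter.C ∉ W) :
    (subst W).numR = 3 * W.numR + 2 * W.count Letter.L := by
  induction W with
  | nil => rfl
  | cons l W ih =>
    have h1 : subst (l :: W) = rule l ++ subst W := by simp [subst]
    have h2 : (rule l ++ subst W).numR = (rule l).numR + (subst W).numR := by
      simp [numR]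
    rw [h1, h2, ih (fun h => hW (List.mem_cons_of_mem _ h))]
    cases l
    · simp [rule, numR]; ring
    · simp [rule, numR]; ring
    · simp at hW

theorem notMem_subst (W : Word) (hW : Letter.C ∉ W) : Letter.C ∉ subst W := by
  intro h
  obtain ⟨l, hl, h⟩ := List.mem_flatMap.1 h
  cases l
  · simp [rule] at h
  · simp [rule] at h
  · exact hW hl

theorem notMem_word (n : ℕ) : Letter.C ∉ word (n + 1) := by
  induction n with
  | zero => decide
  | succ n ih => rw [word_succ_succ]; exact notMem_subst _ ih

theorem notMem_suffix (n : ℕ) : Letter.C ∉ suffix n := by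
  intro h
  apply notMem_word (n + 1)
  rw [word_eq_append_suffix]
  exact List.mem_append_right _ h

theorem odd_numR_word (n : ℕ) : Odd (word (n + 1)).numR := by
  induction n with
  | zero => decide
  | succ n ih =>
    rw [word_succ_succ, numR_subst _ (notMem_word n)]
    have h3 : Odd (3 : ℕ) := by decide
    exact (h3.mul ih).add_even (even_two_mul _)

theorem wordSign_word (n : ℕ) : wordSign (word (n + 1)) = -1 := by
  rw [wordSign_eq_neg_one_pow, (odd_numR_word n).neg_one_pow]

theorem wordSign_suffix (n : ℕ) : wordSign (suffix n) = 1 := by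
  have h := wordSign_word (n + 1)
  rw [word_eq_append_suffix, wordSign_append, wordSign_word] at h
  linarith

theorem len_eq_add (n : ℕ) : len (n + 2) = len (n + 1) + (suffix n).length := by
  simp [len, word_eq_append_suffix]

theorem len_one : len 1 = 1 := by decide

theorem len_two : len 2 = 4 := by decide

theorem len_recursion (n : ℕ) : len (n + 3) + len (n + 1) = 4 * len (n + 2) := by
  have h := len_eq_add n
  have h1 : len (n + 3) = len (n + 2) + (suffix n).length + len (n + 2) + len (n + 2) := by
    simp [len, word_recursion, add_assoc]
  omega

theorem length_suffix_pos (n : ℕ) : 0 < (suffix n).length := by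
  have h : ∀ n, len (n + 1) < len (n + 2) := by
    intro n
    induction n with
    | zero => decide
    | succ n ih => have := len_recursion n; show len (n + 2) < len (n + 3); omega
  have := h n
  have := len_eq_add n
  omega

theorem len_lt_succ (n : ℕ) : len (n + 1) < len (n + 2) := by
  have := length_suffix_pos n
  have := len_eq_add n
  omega

theorem word_ne_nil (n : ℕ) : word (n + 1) ≠ [] := by
  have h := odd_numR_word n
  intro h1
  rw [h1] at h
  exact absurd h (by decide)

/-! ### Recursion of the determinants -/

theorem D_eq_detPoly (n : ℕ) : D (n + 1) = detPoly (word (n + 1)) :=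
  kneadingDet_eq_detPoly _ (notMem_word n)

open Polynomial in
theorem D_eq_sub (n : ℕ) :
    D (n + 2) = D (n + 1) - X ^ len (n + 1) * detPoly (suffix n) := by
  rw [D_eq_detPoly (n + 1), D_eq_detPoly n, word_eq_append_suffix, detPoly_append, wordSign_word,
    len]
  simp only [map_neg, map_one]
  ring

open Polynomial in
theorem D_recursion (n : ℕ) :
    D (n + 3) = aSucc (n + 2) * D (n + 2) + bSucc (n + 2) * D (n + 1) := by
  have h0 := D_eq_sub n
  have h1 : D (n + 3) = D (n + 2) - X ^ len (n + 2) * detPoly (suffix n)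
      - X ^ (len (n + 2) + (suffix n).length) * D (n + 2)
      + X ^ (len (n + 2) + (suffix n).length + len (n + 2)) * D (n + 2) := by
    rw [D_eq_detPoly (n + 2), D_eq_detPoly (n + 1), word_recursion]
    simp only [detPoly_append, wordSign_append, wordSign_word, wordSign_suffix, List.length_append,
      len, mul_one, mul_neg, neg_neg, map_neg, map_one]
    ring
  have h2 := len_eq_add n
  have e1 : len (n + 2) - len (n + 2 - 1) = (suffix n).length := by
    show len (n + 2) - len (n + 1) = _
    omega
  have e2 : 2 * len (n + 2) - len (n + 2 - 1) = len (n + 2) + (suffix n).length := by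
    show 2 * len (n + 2) - len (n + 1) = _
    omega
  have e3 : 3 * len (n + 2) - len (n + 2 - 1) =
      len (n + 2) + (suffix n).length + len (n + 2) := by
    show 3 * len (n + 2) - len (n + 1) = _
    omega
  have h3 : (X : ℝ[X]) ^ len (n + 2) = X ^ (suffix n).length * X ^ len (n + 1) := by
    rw [h2, pow_add, mul_comm]
  -- The suffix polynomial is eliminated through the difference of two consecutive determinants,
  -- which makes the recursion close on the `D`'s alone.
  have h4 : X ^ len (n + 2) * detPoly (suffix n) =
      X ^ (suffix n).length * (D (n + 1) - D (n + 2)) := by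
    rw [h3, h0]
    ring
  rw [h1, h4, aSucc, bSucc, e1, e2, e3]
  ring

/-! ### Existence and monotonicity of the smallest zeros -/

theorem eval_zero_D (n : ℕ) : (D (n + 1)).eval 0 = 1 := by
  rw [D_eq_detPoly]
  obtain ⟨l, W, h⟩ := List.exists_cons_of_ne_nil (word_ne_nil n)
  simp [h, detPoly]

theorem mem_posZeros {n : ℕ} {x : ℝ} : x ∈ (word n).posZeros ↔ 0 < x ∧ (D n).eval x = 0 :=
  Iff.rfl

theorem half_le_of_mem_posZeros {n : ℕ} {x : ℝ} (hx : x ∈ (word (n + 1)).posZeros) :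
    1 / 2 ≤ x := by
  by_contra! h
  obtain ⟨h0, h1⟩ := mem_posZeros.1 hx
  have := eval_detPoly_pos _ (word_ne_nil n) h0.le h
  rw [← D_eq_detPoly, h1] at this
  exact this.false

theorem exists_mem_posZeros_of_nonpos {n : ℕ} {x : ℝ} (h0 : 0 ≤ x)
    (hx : (D (n + 1)).eval x ≤ 0) : ∃ y ∈ (word (n + 1)).posZeros, y ≤ x := by
  have h1 : (0 : ℝ) ∈ Set.Icc ((D (n + 1)).eval x) ((D (n + 1)).eval 0) :=
    ⟨hx, by simp [eval_zero_D]⟩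
  obtain ⟨y, ⟨hy0, hy1⟩, hy⟩ := intermediate_value_Icc' h0 (D (n + 1)).continuousOn h1
  refine ⟨y, ⟨lt_of_le_of_ne hy0 ?_, hy⟩, hy1⟩
  rintro rfl
  simp [eval_zero_D] at hy

/-- Positivity is an open condition, but no zero lies below 1/2, so the set of positive zeros is
closed and its infimum is attained. -/
theorem isLeast_τ {n : ℕ} (h : (word (n + 1)).posZeros.Nonempty) :
    IsLeast (word (n + 1)).posZeros (τ (n + 1)) := by
  have hb : BddBelow (word (n + 1)).posZeros := ⟨1 / 2, fun _ hx => half_le_of_mem_posZeros hx⟩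
  have hc : IsClosed (word (n + 1)).posZeros := by
    have : (word (n + 1)).posZeros = Set.Ici (1 / 2) ∩ (fun x => (D (n + 1)).eval x) ⁻¹' {0} := by
      ext x
      refine ⟨fun hx => ⟨half_le_of_mem_posZeros hx, hx.2⟩, fun hx => ⟨?_, hx.2⟩⟩
      have : 1 / 2 ≤ x := hx.1
      linarith
    rw [this]
    exact isClosed_Ici.inter (isClosed_singleton.preimage (D (n + 1)).continuous)
  exact hc.isLeast_csInf h hb

theorem eval_D_pos_of_lt_τ {n : ℕ} {x : ℝ} (h : IsLeast (word (n + 1)).posZeros (τ (n + 1)))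
    (h0 : 0 ≤ x) (hx : x < τ (n + 1)) : 0 < (D (n + 1)).eval x := by
  by_contra! h1
  obtain ⟨y, hy, hyx⟩ := exists_mem_posZeros_of_nonpos h0 h1
  have := h.2 hy
  linarith

theorem eval_bSucc (n : ℕ) (x : ℝ) :
    (bSucc (n + 2)).eval x = -x ^ (len (n + 2) - len (n + 1)) := by
  simp [bSucc]

theorem eval_bSucc_eq_zero_iff (n : ℕ) (x : ℝ) : (bSucc (n + 2)).eval x = 0 ↔ x = 0 := by
  have := len_lt_succ n
  rw [eval_bSucc, neg_eq_zero, pow_eq_zero_iff (by omega)]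

theorem eval_D_succ_of_zero {n : ℕ} {x : ℝ} (hx : (D (n + 2)).eval x = 0) :
    (D (n + 3)).eval x = -x ^ (len (n + 2) - len (n + 1)) * (D (n + 1)).eval x := by
  rw [D_recursion, Polynomial.eval_add, Polynomial.eval_mul, Polynomial.eval_mul, hx, eval_bSucc]
  ring

theorem D_one : D 1 = 1 := by
  rw [D_eq_detPoly]
  simp [word, detPoly]

theorem D_two : D 2 = 1 - Polynomial.X - Polynomial.X ^ 2 + Polynomial.X ^ 3 := by
  rw [D_eq_detPoly, show word 2 = [Letter.R, Letter.L, Letter.R, Letter.R] by decide]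
  simp [detPoly, letterSign]
  ring

theorem isLeast_τ_succ {n : ℕ} (h : IsLeast (word (n + 2)).posZeros (τ (n + 2)))
    (hp : 0 < (D (n + 1)).eval (τ (n + 2))) :
    IsLeast (word (n + 3)).posZeros (τ (n + 3)) ∧ τ (n + 3) < τ (n + 2) := by
  obtain ⟨h0, h1⟩ := mem_posZeros.1 h.1
  have h2 : (D (n + 3)).eval (τ (n + 2)) < 0 := by
    rw [eval_D_succ_of_zero h1]
    have : 0 < τ (n + 2) ^ (len (n + 2) - len (n + 1)) := by positivity
    nlinarith
  obtain ⟨y, hy, hyx⟩ := exists_mem_posZeros_of_nonpos h0.le h2.le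
  have h3 := isLeast_τ ⟨y, hy⟩
  refine ⟨h3, lt_of_le_of_ne ((h3.2 hy).trans hyx) fun h4 => ?_⟩
  have h5 := (mem_posZeros.1 h3.1).2
  rw [h4] at h5
  linarith

/-- The positivity clause is the induction invariant: it forces the next determinant to be negative
here, and it renews itself because the next zero lies to the left of this least one. -/
theorem τ_spec (n : ℕ) : IsLeast (word (n + 2)).posZeros (τ (n + 2)) ∧
    τ (n + 2) ≤ 1 ∧ 0 < (D (n + 1)).eval (τ (n + 2)) := by
  induction n with
  | zero =>
    have h1 : (1 : ℝ) ∈ (word 2).posZeros := mem_posZeros.2 ⟨one_pos, by simp [D_two]⟩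
    have h2 := isLeast_τ (n := 1) ⟨1, h1⟩
    exact ⟨h2, h2.2 h1, by simp [D_one]⟩
  | succ n ih =>
    obtain ⟨h1, h2, h3⟩ := ih
    obtain ⟨h4, h5⟩ := isLeast_τ_succ h1 h3
    exact ⟨h4, h5.le.trans h2, eval_D_pos_of_lt_τ h1 h4.1.1.le h5⟩

theorem τ_succ_lt (n : ℕ) : τ (n + 3) < τ (n + 2) :=
  (isLeast_τ_succ (τ_spec n).1 (τ_spec n).2.2).2

theorem half_le_τ (n : ℕ) : 1 / 2 ≤ τ (n + 2) := half_le_of_mem_posZeros (τ_spec n).1.1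

theorem eval_D_τ (n : ℕ) : (D (n + 2)).eval (τ (n + 2)) = 0 := (τ_spec n).1.1.2

theorem antitone_τ : Antitone fun n => τ (n + 2) := antitone_nat_of_succ_le fun n => (τ_succ_lt n).le

/-! ### Uniform slope estimates and localisation of the zeros -/

open Polynomial in
theorem exists_D_eq_sub {m n : ℕ} (hmn : m ≤ n) :
    ∃ B : Word, D (n + 1) = D (m + 1) - X ^ len (m + 1) * detPoly B := by
  have h : word (m + 1) <+: word (n + 1) := by
    induction n, hmn using Nat.le_induction with
    | base => exact List.prefix_rfl
    | succ n _ ih => rw [word_eq_append_suffix]; exact ih.trans (List.prefix_append _ _)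
  obtain ⟨B, hB⟩ := h
  refine ⟨B, ?_⟩
  rw [D_eq_detPoly n, D_eq_detPoly m, ← hB, detPoly_append, wordSign_word, len]
  simp only [map_neg, map_one]
  ring

theorem abs_eval_D_sub_le {m n : ℕ} (hmn : m ≤ n) {x : ℝ} (h0 : 0 ≤ x) (h1 : x < 1) :
    |(D (n + 1)).eval x - (D (m + 1)).eval x| ≤ x ^ len (m + 1) * (1 / (1 - x)) := by
  obtain ⟨B, hB⟩ := exists_D_eq_sub hmn
  have : (D (n + 1)).eval x - (D (m + 1)).eval x =
      -(x ^ len (m + 1) * (detPoly B).eval x) := by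
    simp [hB]
  rw [this, abs_neg, abs_mul, abs_of_nonneg (pow_nonneg h0 _)]
  gcongr
  exact abs_eval_detPoly_le B h0 h1

theorem abs_eval_derivative_D_sub_le {m n : ℕ} (hmn : m ≤ n) {x : ℝ} (h0 : 0 ≤ x) (h1 : x < 1) :
    |(D (n + 1)).derivative.eval x - (D (m + 1)).derivative.eval x| ≤
      len (m + 1) * x ^ (len (m + 1) - 1) * (1 / (1 - x)) +
        x ^ len (m + 1) * (1 / (1 - x) ^ 2) := by
  obtain ⟨B, hB⟩ := exists_D_eq_sub hmn
  have : (D (n + 1)).derivative.eval x - (D (m + 1)).derivative.eval x =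
      -(len (m + 1) * x ^ (len (m + 1) - 1) * (detPoly B).eval x +
        x ^ len (m + 1) * (detPoly B).derivative.eval x) := by
    simp [hB, Polynomial.derivative_X_pow]
  rw [this, abs_neg]
  refine (abs_add_le _ _).trans ?_
  rw [abs_mul, abs_mul (x ^ len (m + 1)), abs_of_nonneg (pow_nonneg h0 (len (m + 1))),
    abs_of_nonneg (by positivity : 0 ≤ (len (m + 1) : ℝ) * x ^ (len (m + 1) - 1))]
  gcongr
  · exact abs_eval_detPoly_le B h0 h1
  · exact abs_eval_derivative_detPoly_le B h0 h1

theorem len_three : len 3 = 15 := by decide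

theorem len_four : len 4 = 56 := by
  have h : len 4 + len 2 = 4 * len 3 := len_recursion 1
  rw [len_two, len_three] at h
  omega

theorem D_three : D 3 = (1 + Polynomial.X ^ 3 - Polynomial.X ^ 7 + Polynomial.X ^ 11) * D 2 -
    Polynomial.X ^ 3 := by
  have := D_recursion 0
  simp only [aSucc, bSucc, zero_add, D_one] at this
  rw [this, len_two, show len (2 - 1) = 1 from len_one]
  ring

theorem eval_D_four (x : ℝ) : (D 4).eval x =
    (1 + x ^ 11 - x ^ 26 + x ^ 41) * (D 3).eval x - x ^ 11 * (D 2).eval x := by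
  have := D_recursion 1
  simp only [aSucc, bSucc, Nat.reduceAdd] at this
  rw [this, len_three, show len (3 - 1) = 4 from len_two]
  simp
  ring

/-- The derivative is grouped into blocks: those in `e1`, `e2`, `e3` enter with a negative sign and
are dropped, `e7` gives the main term, and `e4` bounds the only block that may be positive. -/
theorem eval_derivative_D_three_le {x : ℝ} (h0 : 1 / 2 ≤ x) (h1 : x ≤ 13 / 20) :
    (D 3).derivative.eval x ≤ -4 / 5 := by
  have h2 : (D 3).derivative.eval x = -1 - 2 * x + 3 * x ^ 2 - 4 * x ^ 3 - 5 * x ^ 4 + 6 * x ^ 5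
      - 7 * x ^ 6 + 8 * x ^ 7 + 9 * x ^ 8 - 10 * x ^ 9 + 11 * x ^ 10 - 12 * x ^ 11 - 13 * x ^ 12
      + 14 * x ^ 13 := by
    simp [D_three, D_two]
    ring
  have e1 : 0 ≤ x ^ 3 * (4 + 5 * x - 6 * x ^ 2) := by
    have : 0 ≤ 4 + 5 * x - 6 * x ^ 2 := by nlinarith
    positivity
  have e2 : 0 ≤ x ^ 9 * (10 - 11 * x) := by
    have : 0 ≤ 10 - 11 * x := by linarith
    positivity
  have e3 : 0 ≤ x ^ 11 * (12 + 13 * x - 14 * x ^ 2) := by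
    have : 0 ≤ 12 + 13 * x - 14 * x ^ 2 := by nlinarith
    positivity
  have e4 : x ^ 6 * (-7 + 8 * x + 9 * x ^ 2) ≤ (13 / 20) ^ 6 * (201 / 100) := by
    have e5 : x ^ 6 ≤ (13 / 20) ^ 6 := by gcongr
    have e6 : -7 + 8 * x + 9 * x ^ 2 ≤ 201 / 100 := by nlinarith
    calc x ^ 6 * (-7 + 8 * x + 9 * x ^ 2) ≤ x ^ 6 * (201 / 100) := by gcongr
      _ ≤ _ := by gcongr
  have e7 : -1 - 2 * x + 3 * x ^ 2 ≤ -103 / 100 := by nlinarith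
  rw [h2]
  norm_num at e4
  nlinarith

/-- All these determinants agree with `D 3` below degree 15, so the slope -4/5 deteriorates by at
most 3/10. -/
theorem eval_derivative_D_le (n : ℕ) {x : ℝ} (h0 : 1 / 2 ≤ x) (h1 : x ≤ 13 / 20) :
    (D (n + 3)).derivative.eval x ≤ -1 / 2 := by
  have h2 := abs_eval_derivative_D_sub_le (m := 2) (n := n + 2) (by omega) (x := x)
    (by linarith) (by linarith)
  have h3 := eval_derivative_D_three_le h0 h1
  have h4 : (len (2 + 1) : ℝ) * x ^ (len (2 + 1) - 1) * (1 / (1 - x)) +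
        x ^ len (2 + 1) * (1 / (1 - x) ^ 2) ≤ 3 / 10 := by
    have hp : 7 / 20 ≤ 1 - x := by linarith
    have a1 : 1 / (1 - x) ≤ 1 / (7 / 20) := by gcongr
    have a2 : 1 / (1 - x) ^ 2 ≤ 1 / (7 / 20) ^ 2 := by gcongr
    have a3 : x ^ 14 ≤ (13 / 20) ^ 14 := by gcongr
    have a4 : x ^ 15 ≤ (13 / 20) ^ 15 := by gcongr
    have a5 : 0 ≤ 1 - x := by linarith
    show (len 3 : ℝ) * x ^ (len 3 - 1) * (1 / (1 - x)) + x ^ len 3 * (1 / (1 - x) ^ 2) ≤ 3 / 10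
    rw [len_three]
    calc ((15 : ℕ) : ℝ) * x ^ 14 * (1 / (1 - x)) + x ^ 15 * (1 / (1 - x) ^ 2)
        ≤ ((15 : ℕ) : ℝ) * (13 / 20) ^ 14 * (1 / (7 / 20)) +
            (13 / 20) ^ 15 * (1 / (7 / 20) ^ 2) := by gcongr
      _ ≤ 3 / 10 := by norm_num
  have h5 := (abs_le.1 (h2.trans h4)).2
  have h6 : (D (n + 2 + 1)).derivative.eval x - (D 3).derivative.eval x ≤ 3 / 10 := h5
  show (D (n + 2 + 1)).derivative.eval x ≤ -1 / 2
  linarith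

/-- Quantitative decrease of the kneading determinants on `[1/2, 13/20]`. -/
theorem half_mul_sub_le (n : ℕ) {x y : ℝ} (h0 : 1 / 2 ≤ x) (hxy : x ≤ y) (h1 : y ≤ 13 / 20) :
    1 / 2 * (y - x) ≤ (D (n + 3)).eval x - (D (n + 3)).eval y := by
  rcases hxy.eq_or_lt with rfl | hlt
  · simp
  obtain ⟨c, ⟨hc0, hc1⟩, hc⟩ := exists_hasDerivAt_eq_slope (fun x => (D (n + 3)).eval x)
    (fun x => (D (n + 3)).derivative.eval x) hlt (D (n + 3)).continuousOn
    (fun x _ => (D (n + 3)).hasDerivAt x)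
  have h2 := eval_derivative_D_le n (x := c) (by linarith) (by linarith)
  have h3 : 0 < y - x := by linarith
  rw [eq_div_iff h3.ne'] at hc
  nlinarith

theorem τ_le (n : ℕ) : τ (n + 4) ≤ 0.63864 := by
  have h1 : (D 4).eval 0.63864 ≤ 0 := by
    rw [eval_D_four, D_three, D_two]
    norm_num
  obtain ⟨y, hy, hyx⟩ := exists_mem_posZeros_of_nonpos (n := 3) (by norm_num) h1
  have h2 : τ (n + 4) ≤ τ 4 := antitone_τ (show 2 ≤ n + 2 by omega)
  exact h2.trans (((τ_spec 2).1.2 hy).trans hyx)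

theorem le_τ (n : ℕ) : 0.63859 ≤ τ (n + 4) := by
  -- The margin absorbs the tail, which starts in degree 56; monotonicity then excludes a zero to
  -- the left.
  have h1 : 1 / 100000 < (D 4).eval 0.63859 := by
    rw [eval_D_four, D_three, D_two]
    norm_num
  have h2 := abs_eval_D_sub_le (m := 3) (n := n + 3) (by omega) (x := 0.63859)
    (by norm_num) (by norm_num)
  have h3 : (0.63859 : ℝ) ^ len (3 + 1) * (1 / (1 - 0.63859)) ≤ 1 / 100000 := by
    show (0.63859 : ℝ) ^ len 4 * (1 / (1 - 0.63859)) ≤ 1 / 100000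
    rw [len_four]
    norm_num
  have h4 : |(D (n + 1 + 3)).eval 0.63859 - (D 4).eval 0.63859| ≤ 1 / 100000 := h2.trans h3
  have h5 := (abs_le.1 h4).1
  by_contra! h6
  have h7 := half_mul_sub_le (n + 1) (half_le_τ (n + 2)) h6.le (by norm_num)
  have h8 : (D (n + 1 + 3)).eval (τ (n + 2 + 2)) = 0 := eval_D_τ (n + 2)
  have h9 : τ (n + 2 + 2) < 0.63859 := h6
  linarith

/-! ### The limit of the zeros and of the entropies -/

/-- The limit of the zeros `τ n`. -/
noncomputable def τLim : ℝ := ⨅ n, τ (n + 2)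

theorem tendsto_τ_add_two : Tendsto (fun n => τ (n + 2)) atTop (𝓝 τLim) :=
  tendsto_atTop_ciInf antitone_τ ⟨1 / 2, by rintro _ ⟨n, rfl⟩; exact half_le_τ n⟩

theorem tendsto_τ : Tendsto τ atTop (𝓝 τLim) := (tendsto_add_atTop_iff_nat 2).1 tendsto_τ_add_two

theorem le_τLim : 0.63859 ≤ τLim :=
  ge_of_tendsto' ((tendsto_add_atTop_iff_nat 4).2 tendsto_τ) le_τ

theorem τLim_le : τLim ≤ 0.63864 :=
  le_of_tendsto' ((tendsto_add_atTop_iff_nat 4).2 tendsto_τ) τ_le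

theorem τLim_pos : 0 < τLim := lt_of_lt_of_le (by norm_num) le_τLim

theorem τLim_le_τ (n : ℕ) : τLim ≤ τ (n + 2) :=
  antitone_τ.le_of_tendsto tendsto_τ_add_two n

theorem h_eq (n : ℕ) : h n = -Real.log (τ n) := rfl

theorem tendsto_h : Tendsto h atTop (𝓝 (-Real.log τLim)) :=
  (tendsto_τ.log τLim_pos.ne').neg

theorem le_neg_log_τLim : 0.4484 ≤ -Real.log τLim := by
  have h1 : Real.exp 0.4484 ≤ 1 / 0.63864 := by
    refine (Real.exp_bound' (n := 8) (by norm_num) (by norm_num) (by norm_num)).trans ?_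
    norm_num [Finset.sum_range_succ, Nat.factorial]
  have h2 : Real.exp 0.4484 ≤ τLim⁻¹ := by
    refine h1.trans ?_
    rw [one_div]
    exact inv_anti₀ τLim_pos τLim_le
  rw [← Real.log_inv]
  exact (Real.le_log_iff_exp_le (inv_pos.2 τLim_pos)).2 h2

theorem neg_log_τLim_lt : -Real.log τLim < 0.4485 := by
  have h1 : 1 / 0.63859 < Real.exp 0.4485 := by
    refine lt_of_lt_of_le ?_ (Real.sum_le_exp_of_nonneg (by norm_num) 8)
    norm_num [Finset.sum_range_succ, Nat.factorial]
  have h2 : τLim⁻¹ < Real.exp 0.4485 := by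
    refine lt_of_le_of_lt ?_ h1
    rw [one_div]
    exact inv_anti₀ (by norm_num) le_τLim
  rw [← Real.log_inv]
  exact (Real.log_lt_iff_lt_exp (inv_pos.2 τLim_pos)).2 h2

theorem le_len (n : ℕ) : n ≤ len (n + 1) := by
  induction n with
  | zero => omega
  | succ n ih =>
    have := len_lt_succ n
    show n + 1 ≤ len (n + 2)
    omega

theorem tendsto_len : Tendsto (fun n => len (n + 1)) atTop atTop :=
  tendsto_atTop_mono le_len tendsto_id

/-- The zeros converge doubly exponentially fast. -/
theorem τ_sub_τLim_le (n : ℕ) : τ (n + 4) - τLim ≤ 6 * 0.63864 ^ len (n + 4) := by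
  have h1 : ∀ m, n ≤ m → τ (n + 4) - τ (m + 4) ≤ 6 * 0.63864 ^ len (n + 4) := by
    intro m hm
    have hτ := τ_le n
    have h0 : 1 / 2 ≤ τ (n + 4) := half_le_τ (n + 2)
    have h2 := half_mul_sub_le (m + 1) (x := τ (m + 4)) (y := τ (n + 4)) (half_le_τ (m + 2))
      (antitone_τ (show n + 2 ≤ m + 2 by omega)) (hτ.trans (by norm_num))
    have h3 : (D (m + 1 + 3)).eval (τ (m + 4)) = 0 := eval_D_τ (m + 2)
    have h4 := abs_eval_D_sub_le (m := n + 3) (n := m + 3) (by omega) (x := τ (n + 4))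
      (by linarith) (by linarith)
    have h5 : (D (n + 3 + 1)).eval (τ (n + 4)) = 0 := eval_D_τ (n + 2)
    rw [h5, sub_zero] at h4
    have h6 := (abs_le.1 h4).1
    have h7 : τ (n + 4) ^ len (n + 3 + 1) * (1 / (1 - τ (n + 4))) ≤
        0.63864 ^ len (n + 3 + 1) * (1 / (1 - 0.63864)) := by
      have : 0 < 1 - τ (n + 4) := by linarith
      gcongr
    -- Dividing the tail factor 3 by the slope 1/2 gives the constant 6.
    have h8 : (0.63864 : ℝ) ^ len (n + 3 + 1) * (1 / (1 - 0.63864)) ≤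
        0.63864 ^ len (n + 3 + 1) * 3 := by
      gcongr
      norm_num
    have h9 : (D (m + 1 + 3)).eval (τ (n + 4)) = (D (m + 3 + 1)).eval (τ (n + 4)) := rfl
    have h10 : (0.63864 : ℝ) ^ len (n + 3 + 1) = 0.63864 ^ len (n + 4) := rfl
    linarith
  refine le_of_tendsto (tendsto_const_nhds.sub ((tendsto_add_atTop_iff_nat 4).2 tendsto_τ)) ?_
  filter_upwards [eventually_ge_atTop n] with m hm using h1 m hm

/-! ### The ratio of successive entropy differences -/

/-- `C_{n+2} - C_{n+1}` as a natural number. -/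
def gap (n : ℕ) : ℕ := len (n + 2) - len (n + 1)

theorem exists_slope_D (n : ℕ) {x y : ℝ} (hxy : x < y) :
    ∃ c ∈ Set.Ioo x y, (D n).derivative.eval c * (y - x) = (D n).eval y - (D n).eval x := by
  obtain ⟨c, hc, h⟩ := exists_hasDerivAt_eq_slope (fun x => (D n).eval x)
    (fun x => (D n).derivative.eval x) hxy (D n).continuousOn (fun x _ => (D n).hasDerivAt x)
  have : 0 < y - x := by linarith
  exact ⟨c, hc, by rwa [eq_div_iff this.ne'] at h⟩

theorem exists_slope_log {x y : ℝ} (hx : 0 < x) (hxy : x < y) :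
    ∃ c ∈ Set.Ioo x y, Real.log y - Real.log x = (y - x) / c := by
  obtain ⟨c, hc, h⟩ := exists_hasDerivAt_eq_slope Real.log (fun x => x⁻¹) hxy
    (Real.continuousOn_log.mono fun z hz => (hx.trans_le hz.1).ne')
    (fun z hz => Real.hasDerivAt_log (hx.trans hz.1).ne')
  have : 0 < y - x := by linarith
  refine ⟨c, hc, ?_⟩
  rw [eq_div_iff this.ne'] at h
  rw [← h, div_eq_inv_mul]

/-- The quotient of successive differences of entropies. -/
noncomputable def ratio (n : ℕ) : ℝ := (h n - h (n - 1)) / (h (n + 1) - h n)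

/-- Mean values of two determinants turn the recursion at the middle zero into a relation between
consecutive gaps of zeros; mean values of the logarithm pass from zeros to entropies. -/
theorem exists_ratio_eq (n : ℕ) : ∃ ξ ∈ Set.Icc τLim (τ (n + 4)), ∃ η ∈ Set.Icc τLim (τ (n + 4)),
    ∃ ζ ∈ Set.Icc τLim (τ (n + 4)), ∃ ζ' ∈ Set.Icc τLim (τ (n + 4)),
      ratio (n + 5) = ζ' / ζ * ((D (n + 6)).derivative.eval ξ / (D (n + 4)).derivative.eval η) *
        Real.exp (h (n + 5) * gap (n + 3)) := by
  have t4 : 1 / 2 ≤ τ (n + 4) := half_le_τ (n + 2)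
  have t5 : 1 / 2 ≤ τ (n + 5) := half_le_τ (n + 3)
  have t6 : 1 / 2 ≤ τ (n + 6) := half_le_τ (n + 4)
  have l5 : τ (n + 5) < τ (n + 4) := τ_succ_lt (n + 2)
  have l6 : τ (n + 6) < τ (n + 5) := τ_succ_lt (n + 3)
  have i5 : τLim ≤ τ (n + 5) := τLim_le_τ (n + 3)
  have i6 : τLim ≤ τ (n + 6) := τLim_le_τ (n + 4)
  obtain ⟨ξ, ⟨ξ0, ξ1⟩, hξ⟩ := exists_slope_D (n + 6) l6
  obtain ⟨η, ⟨η0, η1⟩, hη⟩ := exists_slope_D (n + 4) l5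
  obtain ⟨ζ, ⟨ζ0, ζ1⟩, hζ⟩ := exists_slope_log (by linarith) l5
  obtain ⟨ζ', ⟨ζ0', ζ1'⟩, hζ'⟩ := exists_slope_log (by linarith) l6
  refine ⟨ξ, ⟨by linarith, by linarith⟩, η, ⟨by linarith, by linarith⟩, ζ,
    ⟨by linarith, by linarith⟩, ζ', ⟨by linarith, by linarith⟩, ?_⟩
  have hle := τ_le n
  have e4 : (D (n + 4)).eval (τ (n + 4)) = 0 := eval_D_τ (n + 2)
  have e5 : (D (n + 5)).eval (τ (n + 5)) = 0 := eval_D_τ (n + 3)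
  have e6 : (D (n + 6)).eval (τ (n + 6)) = 0 := eval_D_τ (n + 4)
  have hr : (D (n + 6)).eval (τ (n + 5)) = -τ (n + 5) ^ gap (n + 3) * (D (n + 4)).eval (τ (n + 5)) :=
    eval_D_succ_of_zero (n := n + 3) e5
  have dξ : (D (n + 6)).derivative.eval ξ ≤ -1 / 2 :=
    eval_derivative_D_le (n + 3) (by linarith) (by linarith)
  have dη : (D (n + 4)).derivative.eval η ≤ -1 / 2 :=
    eval_derivative_D_le (n + 1) (by linarith) (by linarith)
  have hexp : Real.exp (h (n + 5) * gap (n + 3)) = (τ (n + 5) ^ gap (n + 3))⁻¹ := by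
    rw [mul_comm, Real.exp_nat_mul, h_eq, Real.exp_neg, Real.exp_log (by linarith), inv_pow]
  have hp : 0 < τ (n + 5) ^ gap (n + 3) := by
    have : 0 < τ (n + 5) := by linarith
    positivity
  have hq : ratio (n + 5) = ((τ (n + 4) - τ (n + 5)) / ζ) / ((τ (n + 5) - τ (n + 6)) / ζ') := by
    rw [← hζ, ← hζ']
    simp only [ratio, h_eq, show n + 5 - 1 = n + 4 by omega]
    congr 1 <;> ring
  rw [hq, hexp]
  rw [e6, sub_zero, hr] at hξ
  rw [e4, zero_sub] at hη
  have hζpos : 0 < ζ := by linarith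
  have hζpos' : 0 < ζ' := by linarith
  have d1 : 0 < τ (n + 5) - τ (n + 6) := by linarith
  have dη' : (D (n + 4)).derivative.eval η ≠ 0 := by linarith
  have hkey : (D (n + 6)).derivative.eval ξ * (τ (n + 5) - τ (n + 6)) =
      τ (n + 5) ^ gap (n + 3) * ((D (n + 4)).derivative.eval η * (τ (n + 4) - τ (n + 5))) := by
    rw [hξ, hη]
    ring
  field_simp
  linear_combination -hkey

theorem abs_eval_derivative_D_sub_le_mul (n : ℕ) {a b x y : ℝ} (ha : 0 ≤ a) (hb : b ≤ 13 / 20)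
    (hx : x ∈ Set.Icc a b) (hy : y ∈ Set.Icc a b) :
    |(D (n + 1)).derivative.eval x - (D (n + 1)).derivative.eval y| ≤ 50 * (b - a) := by
  have h1 := (convex_Icc a b).norm_image_sub_le_of_norm_hasDerivWithin_le
    (f := fun x => (D (n + 1)).derivative.eval x)
    (f' := fun x => (D (n + 1)).derivative.derivative.eval x) (C := 50)
    (fun z _ => ((D (n + 1)).derivative.hasDerivAt z).hasDerivWithinAt) (fun z hz => ?_) hy hx
  · refine h1.trans ?_
    gcongr
    rw [Real.norm_eq_abs, abs_le]
    constructor <;> linarith [hx.1, hx.2, hy.1, hy.2]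
  · have h2 : 7 / 20 ≤ 1 - z := by linarith [hz.2]
    rw [Real.norm_eq_abs, D_eq_detPoly]
    refine (abs_eval_derivative_derivative_detPoly_le _ (ha.trans hz.1) (by linarith)).trans ?_
    calc 2 / (1 - z) ^ 3 ≤ 2 / (7 / 20) ^ 3 := by gcongr
      _ ≤ 50 := by norm_num

theorem tendsto_len_mul_pow {r : ℝ} (h0 : 0 ≤ r) (h1 : r < 1) :
    Tendsto (fun n => (len (n + 1) : ℝ) * r ^ len (n + 1)) atTop (𝓝 0) :=
  (tendsto_self_mul_const_pow_of_lt_one h0 h1).comp tendsto_len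

theorem tendsto_pow_len {r : ℝ} (h0 : 0 ≤ r) (h1 : r < 1) :
    Tendsto (fun n => r ^ len (n + 1)) atTop (𝓝 0) :=
  (tendsto_pow_atTop_nhds_zero_of_lt_one h0 h1).comp tendsto_len

theorem tendsto_of_mem_Icc_τ {u : ℕ → ℝ} (hu : ∀ n, u n ∈ Set.Icc τLim (τ (n + 4))) :
    Tendsto u atTop (𝓝 τLim) :=
  tendsto_of_tendsto_of_tendsto_of_le_of_le tendsto_const_nhds
    ((tendsto_add_atTop_iff_nat 4).2 tendsto_τ) (fun n => (hu n).1) (fun n => (hu n).2)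

/-- Numerator and denominator differ by a tail and by a shift of the argument, both tending to 0,
while the denominator stays below -1/2. -/
theorem tendsto_derivative_quotient {ξ η : ℕ → ℝ} (hξ : ∀ n, ξ n ∈ Set.Icc τLim (τ (n + 4)))
    (hη : ∀ n, η n ∈ Set.Icc τLim (τ (n + 4))) :
    Tendsto (fun n => (D (n + 6)).derivative.eval (ξ n) / (D (n + 4)).derivative.eval (η n))
      atTop (𝓝 1) := by
  have hl := le_τLim
  -- Here 3 and 9 bound the factors 1/(1 - ξ) and 1/(1 - ξ)²; 60/13 = 3 · 20/13 also restores the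
  -- power lowered by differentiation.
  set E : ℕ → ℝ := fun n => (len (n + 4) * (13 / 20) ^ len (n + 4)) * (60 / 13)
    + (13 / 20) ^ len (n + 4) * 9 + 50 * (τ (n + 4) - τLim) with hE
  have hE0 : Tendsto E atTop (𝓝 0) := by
    have t1 := (tendsto_add_atTop_iff_nat 3).2
      (tendsto_len_mul_pow (r := 13 / 20) (by norm_num) (by norm_num))
    have t2 := (tendsto_add_atTop_iff_nat 3).2
      (tendsto_pow_len (r := 13 / 20) (by norm_num) (by norm_num))
    have t3 := ((tendsto_add_atTop_iff_nat 4).2 tendsto_τ).sub_const τLim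
    have := ((t1.mul_const (60 / 13)).add (t2.mul_const 9)).add (t3.const_mul 50)
    simpa using this
  have hb : ∀ n, |(D (n + 6)).derivative.eval (ξ n) - (D (n + 4)).derivative.eval (η n)| ≤ E n := by
    intro n
    have hτ := τ_le n
    obtain ⟨x0, x1⟩ := hξ n
    have b1 := abs_eval_derivative_D_sub_le (m := n + 3) (n := n + 5) (by omega) (x := ξ n)
      (by linarith) (by linarith)
    have b2 := abs_eval_derivative_D_sub_le_mul (n + 3) (by linarith)
      (hτ.trans (by norm_num)) (hξ n) (hη n)
    have hlen : len (n + 4) ≠ 0 := by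
      have : n + 3 ≤ len (n + 4) := le_len (n + 3)
      omega
    have b3 : (len (n + 4) : ℝ) * ξ n ^ (len (n + 4) - 1) * (1 / (1 - ξ n)) +
        ξ n ^ len (n + 4) * (1 / (1 - ξ n) ^ 2) ≤
        (len (n + 4) * (13 / 20) ^ len (n + 4)) * (60 / 13) + (13 / 20) ^ len (n + 4) * 9 := by
      have hp : 7 / 20 ≤ 1 - ξ n := by linarith
      have y0 : 0 ≤ ξ n := by linarith
      have y1 : ξ n ≤ 13 / 20 := by linarith
      have a1 : 1 / (1 - ξ n) ≤ 3 := by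
        rw [div_le_iff₀ (by linarith)]
        linarith
      have a2 : 1 / (1 - ξ n) ^ 2 ≤ 9 := by
        have : 1 / (1 - ξ n) ^ 2 = (1 / (1 - ξ n)) ^ 2 := by rw [div_pow, one_pow]
        rw [this]
        have : 0 ≤ 1 / (1 - ξ n) := by
          apply div_nonneg <;> linarith
        nlinarith
      have a3 : ((13 : ℝ) / 20) ^ len (n + 4) = (13 / 20) ^ (len (n + 4) - 1) * (13 / 20) := by
        rw [← pow_succ, Nat.sub_add_cancel (by omega)]
      have a4 : (len (n + 4) : ℝ) * (13 / 20) ^ len (n + 4) * (60 / 13) =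
          len (n + 4) * (13 / 20) ^ (len (n + 4) - 1) * 3 := by
        rw [a3]
        ring
      rw [a4]
      gcongr
    calc |(D (n + 6)).derivative.eval (ξ n) - (D (n + 4)).derivative.eval (η n)|
        ≤ |(D (n + 6)).derivative.eval (ξ n) - (D (n + 4)).derivative.eval (ξ n)| +
          |(D (n + 4)).derivative.eval (ξ n) - (D (n + 4)).derivative.eval (η n)| :=
          abs_sub_le _ _ _
      _ ≤ E n := add_le_add (b1.trans b3) b2
  have hq : ∀ n, ‖(D (n + 6)).derivative.eval (ξ n) / (D (n + 4)).derivative.eval (η n) - 1‖ ≤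
      2 * E n := by
    intro n
    have hτ := τ_le n
    obtain ⟨y0, y1⟩ := hη n
    have d : (D (n + 4)).derivative.eval (η n) ≤ -1 / 2 :=
      eval_derivative_D_le (n + 1) (by linarith) (by linarith)
    have d0 : (D (n + 4)).derivative.eval (η n) ≠ 0 := by linarith
    have d1 : 1 / 2 ≤ |(D (n + 4)).derivative.eval (η n)| := by
      rw [abs_of_neg (by linarith)]
      linarith
    rw [div_sub_one d0, Real.norm_eq_abs, abs_div, div_le_iff₀ (by linarith)]
    have := hb n
    have := (abs_nonneg _).trans (hb n)
    nlinarith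
  rw [← tendsto_sub_nhds_zero_iff]
  refine squeeze_zero_norm hq ?_
  simpa using hE0.const_mul 2

/-! ### Closed forms of the lengths and the final asymptotics -/

theorem len_closed_form (n : ℕ) :
    (len (n + 1) : ℝ) * (2 * √3) = (2 + √3) ^ (n + 1) - (2 - √3) ^ (n + 1) := by
  have hs : √3 * √3 = (3 : ℝ) := Real.mul_self_sqrt (by norm_num)
  induction n using Nat.strong_induction_on with
  | _ n ih =>
    match n with
    | 0 => simp [len_one]; ring
    | 1 => simp [len_two]; ring
    | n + 2 =>
      have h1 := ih n (by omega)
      have h2 := ih (n + 1) (by omega)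
      have h3 : (len (n + 3) : ℝ) + len (n + 1) = 4 * len (n + 2) := by
        exact_mod_cast len_recursion n
      have h4 : (len (n + 2 + 1) : ℝ) = 4 * len (n + 2) - len (n + 1) := by
        linarith
      have h5 : (len (n + 2) : ℝ) * (2 * √3) = (2 + √3) ^ (n + 2) - (2 - √3) ^ (n + 2) := h2
      rw [h4, sub_mul, mul_assoc, h1, h5]
      linear_combination ((2 - √3) ^ (n + 1) - (2 + √3) ^ (n + 1)) * hs

theorem gap_closed_form (n : ℕ) :
    (gap n : ℝ) = (1 + √3) / (6 + 4 * √3) * (2 + √3) ^ (n + 2) +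
      (1 + √3) / (2 * √3) * (2 - √3) ^ (n + 2) := by
  have hs : √3 * √3 = (3 : ℝ) := Real.mul_self_sqrt (by norm_num)
  have hp : 0 < √3 := by positivity
  have h1 := len_closed_form n
  have h2 : (len (n + 2) : ℝ) * (2 * √3) = (2 + √3) ^ (n + 2) - (2 - √3) ^ (n + 2) :=
    len_closed_form (n + 1)
  have h3 : (gap n : ℝ) = len (n + 2) - len (n + 1) := by
    rw [gap, Nat.cast_sub (len_lt_succ n).le]
  have h4 : (1 + √3) / (6 + 4 * √3) * (2 + √3) = (1 + √3) / (2 * √3) := by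
    field_simp
    linear_combination 2 * hs
  have h5 : (1 + √3) * (2 - √3) = √3 - 1 := by linear_combination -hs
  rw [pow_succ' _ (n + 1), ← mul_assoc, h4, h3]
  field_simp
  rw [pow_succ' (2 - √3) (n + 1)] at *
  linear_combination h2 - h1 - (2 - √3) ^ (n + 1) * h5

/-- The logarithm of the quotient is asymptotically `h_∞ (1 + √3) / (6 + 4 √3) (2 + √3) ^ n`, with
vanishing absolute error. -/
theorem ratio_pos_and_tendsto_log : (∀ n, 0 < ratio (n + 5)) ∧
    Tendsto (fun n => Real.log (ratio (n + 5)) -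
      (1 + √3) / (6 + 4 * √3) * (-Real.log τLim) * (2 + √3) ^ (n + 5)) atTop (𝓝 0) := by
  choose ξ hξ η hη ζ hζ ζ' hζ' hr using exists_ratio_eq
  have hl := le_τLim
  set u : ℕ → ℝ := fun n => ζ' n / ζ n *
    ((D (n + 6)).derivative.eval (ξ n) / (D (n + 4)).derivative.eval (η n)) with hu
  have hu1 : Tendsto u atTop (𝓝 1) := by
    have t1 := (tendsto_of_mem_Icc_τ hζ').div (tendsto_of_mem_Icc_τ hζ) τLim_pos.ne'
    have := t1.mul (tendsto_derivative_quotient hξ hη)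
    rwa [div_self τLim_pos.ne', one_mul] at this
  have hupos : ∀ n, 0 < u n := by
    intro n
    have hτ := τ_le n
    have d1 : (D (n + 6)).derivative.eval (ξ n) ≤ -1 / 2 :=
      eval_derivative_D_le (n + 3) (by linarith [(hξ n).1]) (by linarith [(hξ n).2])
    have d2 : (D (n + 4)).derivative.eval (η n) ≤ -1 / 2 :=
      eval_derivative_D_le (n + 1) (by linarith [(hη n).1]) (by linarith [(hη n).2])
    refine mul_pos (div_pos ?_ ?_) (div_pos_of_neg_of_neg ?_ ?_)
    · linarith [(hζ' n).1]
    · linarith [(hζ n).1]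
    · linarith
    · linarith
  refine ⟨fun n => by rw [hr n]; exact mul_pos (hupos n) (Real.exp_pos _), ?_⟩
  have hlog : ∀ n, Real.log (ratio (n + 5)) = Real.log (u n) + h (n + 5) * gap (n + 3) := by
    intro n
    rw [hr n, Real.log_mul (hupos n).ne' (Real.exp_pos _).ne', Real.log_exp]
  have t1 : Tendsto (fun n => Real.log (u n)) atTop (𝓝 0) := by
    simpa using hu1.log one_ne_zero
  -- The entropy error decays exponentially in the length, which beats the factor `gap`. The
  -- constant is 12 = 2 · 6, with 2 bounding 1/`τLim`.
  have t2 : Tendsto (fun n => (h (n + 5) + Real.log τLim) * gap (n + 3)) atTop (𝓝 0) := by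
    have t3 := ((tendsto_add_atTop_iff_nat 4).2
      (tendsto_len_mul_pow (r := 0.63864) (by norm_num) (by norm_num))).const_mul 12
    rw [mul_zero] at t3
    refine squeeze_zero_norm (fun n => ?_) t3
    have g : (gap (n + 3) : ℝ) ≤ len (n + 5) := by
      exact_mod_cast Nat.sub_le _ _
    have i5 : τLim ≤ τ (n + 5) := τLim_le_τ (n + 3)
    have b : τ (n + 5) - τLim ≤ 6 * 0.63864 ^ len (n + 5) := τ_sub_τLim_le (n + 1)
    have h1 : Real.log (τ (n + 5)) - Real.log τLim ≤ 2 * (τ (n + 5) - τLim) := by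
      rw [← Real.log_div (by linarith) τLim_pos.ne']
      refine (Real.log_le_sub_one_of_pos (div_pos (by linarith) τLim_pos)).trans ?_
      rw [div_sub_one τLim_pos.ne', div_le_iff₀ τLim_pos]
      nlinarith
    have h2 : Real.log τLim ≤ Real.log (τ (n + 5)) := Real.log_le_log τLim_pos i5
    rw [norm_mul, Real.norm_natCast, h_eq, Real.norm_eq_abs,
      abs_of_nonpos (by linarith)]
    calc -(-Real.log (τ (n + 5)) + Real.log τLim) * gap (n + 3)
        ≤ (12 * 0.63864 ^ len (n + 5)) * len (n + 5) := by
          gcongr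
          linarith
      _ = 12 * (len (n + 4 + 1) * 0.63864 ^ len (n + 4 + 1)) := by ring_nf
  have t4 : Tendsto (fun n : ℕ => -Real.log τLim * ((1 + √3) / (2 * √3) * (2 - √3) ^ (n + 5)))
      atTop (𝓝 0) := by
    have s1 : 1 < √3 := by rw [Real.lt_sqrt] <;> norm_num
    have s2 : √3 < 2 := by rw [Real.sqrt_lt'] <;> norm_num
    have := (((tendsto_add_atTop_iff_nat 5).2 (tendsto_pow_atTop_nhds_zero_of_lt_one
      (r := 2 - √3) (by linarith) (by linarith))).const_mul
        ((1 + √3) / (2 * √3))).const_mul (-Real.log τLim)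
    simpa using this
  have t5 := (t1.add t2).add t4
  rw [add_zero, add_zero] at t5
  refine t5.congr fun n => ?_
  rw [hlog, gap_closed_form (n + 3)]
  ring

/-- Factoring out exp g leaves F e^(-g) = 1 + (F - e^g) e^(-g), which tends to 1. -/
theorem tendsto_log_sub_of_tendsto_sub_exp {F g : ℕ → ℝ} (hg : Tendsto g atTop atTop)
    (h : Tendsto (fun n => F n - Real.exp (g n)) atTop (𝓝 0)) :
    Tendsto (fun n => Real.log (F n) - g n) atTop (𝓝 0) := by
  have h1 : Tendsto (fun n => 1 + (F n - Real.exp (g n)) * Real.exp (-g n)) atTop (𝓝 1) := by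
    have := (h.mul (Real.tendsto_exp_neg_atTop_nhds_zero.comp hg)).const_add 1
    simpa using this
  have h2 := h1.log one_ne_zero
  rw [Real.log_one] at h2
  refine h2.congr' ?_
  filter_upwards [h1.eventually_const_lt zero_lt_one] with n hn
  have h3 : 1 + (F n - Real.exp (g n)) * Real.exp (-g n) = F n * Real.exp (-g n) := by
    have : Real.exp (g n) * Real.exp (-g n) = 1 := by rw [← Real.exp_add]; simp
    linear_combination -this
  rw [h3] at hn ⊢
  have h4 : F n ≠ 0 := by
    rintro h0
    simp [h0] at hn
  rw [Real.log_mul h4 (Real.exp_pos _).ne', Real.log_exp]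
  ring

theorem main_asymptotics :
    Tendsto (fun n : ℕ => Real.log (ratio n) - Real.exp ((n : ℝ) * Real.log (2 + √3) +
      Real.log ((1 + √3) / (6 + 4 * √3) * (-Real.log τLim)))) atTop (𝓝 0) := by
  have hpos : 0 < (1 + √3) / (6 + 4 * √3) * (-Real.log τLim) := by
    have := le_neg_log_τLim
    have : 0 < -Real.log τLim := by linarith
    positivity
  refine (tendsto_add_atTop_iff_nat 5).1 (ratio_pos_and_tendsto_log.2.congr fun n => ?_)
  rw [Real.exp_add, Real.exp_log hpos, Real.exp_nat_mul, Real.exp_log (by positivity)]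
  ring

end Clapeyron

theorem mainTheorem6 :
    -- the words, their lengths and parities
    Clapeyron.word 1 = [Letter.R] ∧
    Clapeyron.word 2 = [Letter.R, Letter.L, Letter.R, Letter.R] ∧
    (∀ n : ℕ, 2 ≤ n →
      Clapeyron.word (n - 1) <+: Clapeyron.word n ∧
      Clapeyron.word (n + 1) =
        Clapeyron.word n ++ Word.invMul (Clapeyron.word (n - 1))
          (Clapeyron.word n ++ Clapeyron.word n ++ Clapeyron.word n)) ∧
    Clapeyron.len 1 = 1 ∧ Clapeyron.len 2 = 4 ∧
    (∀ n : ℕ, 2 ≤ n →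
      Clapeyron.len (n - 1) < Clapeyron.len n ∧
      (Clapeyron.len (n + 1) : ℤ) = 4 * Clapeyron.len n - Clapeyron.len (n - 1)) ∧
    (∀ n : ℕ, 1 ≤ n → Odd (Clapeyron.word n).numR) ∧
    -- the full Milnor-Thurston series in terms of the finite degree determinant
    (∀ n : ℕ, 1 ≤ n → ∀ x : ℝ, |x| < 1 →
      HasSum (fun k : ℕ => ((Word.invCoord (Clapeyron.word n).kneadingSeq k : ℤ) : ℝ) * x ^ k)
        ((Clapeyron.D n).eval x / (1 - x ^ Clapeyron.len n))) ∧
    -- the recursion of the finite degree kneading determinants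
    (∀ n : ℕ, 2 ≤ n →
      Clapeyron.D n - Clapeyron.D (n - 1) =
        -(Polynomial.X ^ Clapeyron.len (n - 1) *
          (Word.invMul (Clapeyron.word (n - 1)) (Clapeyron.word n)).kneadingDet) ∧
      Clapeyron.D (n + 1) =
        Clapeyron.aSucc n * Clapeyron.D n + Clapeyron.bSucc n * Clapeyron.D (n - 1) ∧
      (∀ x : ℝ, (Clapeyron.bSucc n).eval x = 0 ↔ x = 0)) ∧
    -- the smallest positive zeros
    (∀ n : ℕ, 2 ≤ n →
      IsLeast (Clapeyron.word n).posZeros (Clapeyron.τ n) ∧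
      1 / 2 ≤ Clapeyron.τ n ∧ Clapeyron.τ n ≤ 1 ∧
      (Clapeyron.bSucc n).eval (Clapeyron.τ n) ≠ 0 ∧
      Clapeyron.τ (n + 1) < Clapeyron.τ n) ∧
    -- the convergence of the entropies
    ∃ hInf : ℝ, Tendsto Clapeyron.h atTop (𝓝 hInf) ∧
      0.4484 ≤ hInf ∧ hInf < 0.4485 ∧
      (fun n : ℕ => (Clapeyron.h n - Clapeyron.h (n - 1)) /
          (Clapeyron.h (n + 1) - Clapeyron.h n)) ~[atTop]
        (fun n : ℕ => Real.exp (Real.exp ((n : ℝ) * Real.log (2 + √3) +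
          Real.log ((1 + √3) / (6 + 4 * √3) * hInf)))) ∧
      Tendsto (fun n : ℕ =>
        Real.log (Real.log ((Clapeyron.h n - Clapeyron.h (n - 1)) /
            (Clapeyron.h (n + 1) - Clapeyron.h n))) -
          ((n : ℝ) * Real.log (2 + √3) + Real.log ((1 + √3) / (6 + 4 * √3) * hInf)))
        atTop (𝓝 0) := by

  open Clapeyron Word in
  have hsub : ∀ n : ℕ, invMul (word (n + 1)) (word (n + 2)) = suffix n := fun n => by
    rw [word_eq_append_suffix, invMul_append]
  refine ⟨by decide, by decide, ?_, len_one, len_two, ?_, ?_, ?_, ?_, ?_, -Real.log τLim, tendsto_h,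
    le_neg_log_τLim, neg_log_τLim_lt, ?_, ?_⟩
  · rintro (_ | _ | n) hn
    · omega
    · omega
    · show word (n + 1) <+: word (n + 2) ∧ word (n + 3) =
        word (n + 2) ++ invMul (word (n + 1)) (word (n + 2) ++ word (n + 2) ++ word (n + 2))
      constructor
      · rw [word_eq_append_suffix]
        exact List.prefix_append _ _
      · have : word (n + 2) ++ word (n + 2) ++ word (n + 2) =
            word (n + 1) ++ (suffix n ++ word (n + 2) ++ word (n + 2)) := by
          conv_lhs => enter [1, 1]; rw [word_eq_append_suffix]
          simp only [List.append_assoc]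
        rw [this, invMul_append, word_recursion]
        simp only [List.append_assoc]
  · rintro (_ | _ | n) hn
    · omega
    · omega
    · refine ⟨len_lt_succ n, ?_⟩
      have := len_recursion n
      show (len (n + 3) : ℤ) = 4 * len (n + 2) - len (n + 1)
      omega
  · rintro (_ | n) hn
    · omega
    · exact odd_numR_word n
  · rintro (_ | n) hn x hx
    · omega
    · exact hasSum_invCoord _ (word_ne_nil n) hx
  · rintro (_ | _ | n) hn
    · omega
    · omega
    · refine ⟨?_, D_recursion n, eval_bSucc_eq_zero_iff n⟩
      show D (n + 2) - D (n + 1) = -(Polynomial.X ^ len (n + 1) *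
        (invMul (word (n + 1)) (word (n + 2))).kneadingDet)
      rw [hsub, kneadingDet_eq_detPoly _ (notMem_suffix n), D_eq_sub]
      ring
  · rintro (_ | _ | n) hn
    · omega
    · omega
    · have h1 := half_le_τ n
      refine ⟨(τ_spec n).1, h1, (τ_spec n).2.1, ?_, τ_succ_lt n⟩
      rw [Ne, eval_bSucc_eq_zero_iff]
      show τ (n + 2) ≠ 0
      linarith
  -- An additive o(1) error in the logarithm exponentiates to a quotient tending to 1; positivity of
  -- the ratio is available from index 5 on.
  · refine isEquivalent_of_tendsto_one ?_
    have h1 := main_asymptotics.rexp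
    rw [Real.exp_zero] at h1
    refine h1.congr' ?_
    filter_upwards [eventually_ge_atTop 5] with n hn
    obtain ⟨m, rfl⟩ := Nat.exists_eq_add_of_le' hn
    rw [Real.exp_sub, Real.exp_log (ratio_pos_and_tendsto_log.1 m)]
    rfl
  · refine tendsto_log_sub_of_tendsto_sub_exp ?_ main_asymptotics
    have : 0 < Real.log (2 + √3) := Real.log_pos (by linarith [Real.sqrt_nonneg 3])
    exact tendsto_atTop_add_const_right _ _ (tendsto_natCast_atTop_atTop.atTop_mul_const this)
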